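/- A pregroup (in the sense of Stallings) is a set $P$ with a distinguished element $\varepsilon$, an involution $a\mapsto\bar a$ and a partial multiplication $(a,b)\mapsto ab$, defined for $(a,b)\in D\subseteq P\times P$ and with values in $P$, such that for all $a,b,c,d\in P$: (P1) $a\varepsilon$ and $\varepsilon a$ are defined and equal to $a$; (P2) $\bar aa$ and $a\bar a$ are defined and equal to $\varepsilon$; (P3) if $ab$ is defined, then so is $\bar b\,\bar a$, and $\overline{ab}=\bar b\,\bar a$; (P4) if $ab$ and $bc$ are defined, then $(ab)c$ is defined if and only if $a(bc)$ is defined, in which case they are equal; (P5) if $ab$, $bc$, $cd$ are defined, then $(ab)c$ or $(bc)d$ is defined. Let $P$ be a pregroup and $\Gamma=P\setminus\{\varepsilon\}$. Write $[ab]$ for the product of $a$ and $b$ in $P$ when it is defined, and $1$ for the empty word. Let $S=S(P)\subseteq\Gamma^*\times\Gamma^*$ consist of the rules (with $a,b\in\Gamma$, $c\in P$) $$ab\to 1\ \text{ if }(a,b)\in D,\ [ab]=\varepsilon;\qquad ab\to[ab]\ \text{ if }(a,b)\in D,\ [ab]\neq\varepsilon;\qquad ab\leftrightarrow[ac][\bar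 cb]\ \text{ if }(a,c),(\bar c,b)\in D,\ (a,b)\notin D,$$ and let $U(P)=\Gamma^*/S$, which is a group. A cyclic word $w_\sim$ is a word $w\in\Gamma^*$ up to cyclic permutation; its length is $|w|$. Write $u_\sim\to^{\circ}_S v_\sim$ if some $u'\in u_\sim$ and $v'\in v_\sim$ satisfy $u'=p\ell q$, $v'=prq$ with $(\ell,r)\in S$. Let $m(S)=\sup\{|\ell| : (\ell,r)\in S\}$ and call $w_\sim$ short if $|w|\le 2m(S)-2$ (if $P\ne\{\varepsilon\}$, then $m(S)=2$, so short means $|w|\le 2$). Let $C^\dagger(S)$ be the relation on cyclic words consisting of all pairs $(u_\sim,v_\sim)$ with $u_\sim\to^\circ_S v_\sim$, together with both $(u_\sim,v_\sim)$ and $(v_\sim,u_\sim)$ whenever there is a short cyclic word $w_\sim$ with $w_\sim\to^\circ_S u_\sim$, $w_\sim\to^\circ_S v_\sim$ and $|w|>|u|\ge|v|\ge1$. A cyclic word $w_\sim$ is geodesic if $|w|$ is minimal among the lengths of all words $u\in\Gamma^*$ that represent an element of $U(P)$ conjugate to $w$. Then $C^\dagger(S)$ is geodesically perfect, that is: 1.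 $C^\dagger(S)$ is a Thue relation on cyclic words (no rule increases the length, and if a length-preserving pair belongs to $C^\dagger(S)$, then so does the reversed pair), it contains $\to^\circ_S$, and $(u_\sim,v_\sim)\in C^\dagger(S)$ implies that $u$ and $v$ are conjugate in $U(P)$. 2. Every cyclic word can be transformed into a geodesic cyclic word by finitely many applications (possibly none) of length-reducing rules of $C^\dagger(S)$. 3. If two geodesic cyclic words $u_\sim$ and $v_\sim$ can both be derived from the same cyclic word by rules of $C^\dagger(S)$, then $u_\sim$ can be transformed into $v_\sim$ by finitely many applications (possibly none) of length-preserving rules of $C^\dagger(S)$. Moreover, if $u_\sim$ and $v_\sim$ are geodesic and $u$, $v$ are conjugate in $U(P)$, then $u_\sim$ can be transformed into $v_\sim$ by finitely many applications (possibly none) of length-preserving rules of $C^\dagger(S)$. -/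

import Mathlib

/-- A semi-Thue system over the alphabet `Γ`: a set of rules `ℓ ⟶ r` between words. -/
abbrev SemiThue (Γ : Type*) := List Γ → List Γ → Prop

namespace SemiThue

variable {Γ : Type*}

/-- The one-step string rewriting relation: `u = pℓq`, `v = prq` for some rule `(ℓ, r)`. -/
def Step (S : SemiThue Γ) (u v : List Γ) : Prop :=
  ∃ p q l r : List Γ, S l r ∧ u = p ++ l ++ q ∧ v = p ++ r ++ q

/-- The quotient monoid `Γ* / S`. -/
abbrev QuotientMonoid (S : SemiThue Γ) : Type _ :=
  PresentedMonoid (fun u v : FreeMonoid Γ => S u.toList v.toList)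

/-- The element of `Γ* / S` represented by a word. -/
def toQuotient (S : SemiThue Γ) (u : List Γ) : S.QuotientMonoid :=
  PresentedMonoid.mk _ (FreeMonoid.ofList u)

/-- Two words are conjugate in `Γ* / S`: some invertible `x` satisfies `x u x⁻¹ = v`.
(In the application `Γ* / S` is a group, so that every element is invertible.) -/
def Conj (S : SemiThue Γ) (u v : List Γ) : Prop :=
  IsConj (S.toQuotient u) (S.toQuotient v)

/-- `m(S)`, the supremum of the lengths of the left-hand sides of rules. -/
noncomputable def leftBound (S : SemiThue Γ) : ℕ∞ :=
  ⨆ (l : List Γ) (r : List Γ) (_ : S l r), (l.length : ℕ∞)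

/-- The one-step rewriting relation induced by `S` on cyclic words (words up to rotation). -/
def CStep (S : SemiThue Γ) (c d : Cycle Γ) : Prop :=
  ∃ u v : List Γ, (u : Cycle Γ) = c ∧ (v : Cycle Γ) = d ∧ S.Step u v

/-- A cyclic word `w` is `S`-short if `|w| ≤ 2 m(S) - 2`. -/
def IsShort (S : SemiThue Γ) (w : Cycle Γ) : Prop :=
  (w.length : ℕ∞) + 2 ≤ 2 * S.leftBound

/-- The short critical pairs `u ⟵ w ⟶ v` with `w` short and `|w| > |u| ≥ |v| ≥ 1`, where both
arrows are cyclic rewriting steps of `S`. -/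
def CriticalPair (S : SemiThue Γ) (u v : Cycle Γ) : Prop :=
  ∃ w : Cycle Γ, S.IsShort w ∧ S.CStep w u ∧ S.CStep w v ∧
    u.length < w.length ∧ v.length ≤ u.length ∧ 1 ≤ v.length

/-- The cyclic rewriting system `C†(S)`: all cyclic rewriting steps of `S`, together with the
rules `(u, v)` and `(v, u)` for every short critical pair `(u, v)`. -/
def CDagger (S : SemiThue Γ) (c d : Cycle Γ) : Prop :=
  S.CStep c d ∨ S.CriticalPair c d ∨ S.CriticalPair d c

/-- A cyclic word is geodesic if its length is minimal among all words representing an element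
of its conjugacy class in `Γ* / S`. -/
def IsGeodesic (S : SemiThue Γ) (c : Cycle Γ) : Prop :=
  ∀ u v : List Γ, (u : Cycle Γ) = c → S.Conj u v → c.length ≤ v.length

end SemiThue

section Cyclic

variable {Γ : Type*}

/-- The length-reducing rules of a relation on cyclic words. -/
def LengthReducing (C : Cycle Γ → Cycle Γ → Prop) (c d : Cycle Γ) : Prop :=
  C c d ∧ d.length < c.length

/-- The length-preserving rules of a relation on cyclic words. -/
def LengthPreserving (C : Cycle Γ → Cycle Γ → Prop) (c d : Cycle Γ) : Prop :=
  C c d ∧ d.length = c.length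

/-- A relation on cyclic words is Thue if no rule increases the length, and the rules that
preserve the length are symmetric. -/
def IsCyclicThue (C : Cycle Γ → Cycle Γ → Prop) : Prop :=
  ∀ c d, C c d → d.length < c.length ∨ (d.length = c.length ∧ C d c)

/-- `C` is geodesically perfect with respect to `S`. -/
structure GeodesicallyPerfect (S : SemiThue Γ) (C : Cycle Γ → Cycle Γ → Prop) : Prop where
  /-- `C` is a Thue relation on cyclic words. -/
  thue : IsCyclicThue C
  /-- `C` contains the cyclic rewriting steps of `S`. -/
  extends_step : ∀ c d, S.CStep c d → C c d
  /-- The rules of `C` relate words that are conjugate in `Γ* / S`. -/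
  sound : ∀ u v : List Γ, C (u : Cycle Γ) (v : Cycle Γ) → S.Conj u v
  /-- Length-reducing rules lead from every cyclic word to a geodesic one. -/
  reduces : ∀ w, ∃ u, Relation.ReflTransGen (LengthReducing C) w u ∧ S.IsGeodesic u
  /-- Two geodesics derived from the same cyclic word are connected by length-preserving rules. -/
  connects : ∀ w u v, Relation.ReflTransGen C w u → Relation.ReflTransGen C w v →
    S.IsGeodesic u → S.IsGeodesic v → Relation.ReflTransGen (LengthPreserving C) u v

end Cyclic

/-- A pregroup in the sense of Stallings. The partial multiplication takes values in `Option P`: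
`pmul a b = some x` means that `ab` is defined and equal to `x`. -/
class Pregroup (P : Type*) where
  /-- The distinguished element. -/
  eps : P
  /-- The involution. -/
  bar : P → P
  /-- The partial multiplication. -/
  pmul : P → P → Option P
  bar_bar : ∀ a, bar (bar a) = a
  pmul_eps : ∀ a, pmul a eps = some a
  eps_pmul : ∀ a, pmul eps a = some a
  bar_pmul : ∀ a, pmul (bar a) a = some eps
  pmul_bar : ∀ a, pmul a (bar a) = some eps
  bar_of_pmul : ∀ a b x, pmul a b = some x → pmul (bar b) (bar a) = some (bar x)
  /-- If `ab = x` and `bc = y` are defined, then `xc` is defined if and only if `ay` is, and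
  in that case the two are equal. -/
  pmul_assoc : ∀ a b c x y, pmul a b = some x → pmul b c = some y → pmul x c = pmul a y
  /-- If `ab = x`, `bc = y` and `cd` are defined, then `(ab)c` or `(bc)d` is defined. -/
  pmul_or : ∀ a b c d x y z, pmul a b = some x → pmul b c = some y → pmul c d = some z →
    (pmul x c).isSome ∨ (pmul y d).isSome

namespace Pregroup

/-- The alphabet `Γ = P \ {ε}`. -/
abbrev Letter (P : Type*) [Pregroup P] : Type _ := {a : P // a ≠ eps}

/-- The Thue system `S(P)` associated with the pregroup `P`. -/
inductive thueSystem (P : Type*) [Pregroup P] : List (Letter P) → List (Letter P) → Prop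
  /-- `ab ⟶ 1` if `[ab] = ε`. -/
  | cancel (a b : Letter P) : pmul a.1 b.1 = some eps → thueSystem P [a, b] []
  /-- `ab ⟶ [ab]` if `ab` is defined and `[ab] ≠ ε`. -/
  | mul (a b x : Letter P) : pmul a.1 b.1 = some x.1 → thueSystem P [a, b] [x]
  /-- `ab ⟶ [ac][c̄b]` if `ac`, `c̄b` are defined and `ab` is not. -/
  | interleave (a b : Letter P) (c : P) (x y : Letter P) : pmul a.1 b.1 = none →
      pmul a.1 c = some x.1 → pmul (bar c) b.1 = some y.1 → thueSystem P [a, b] [x, y]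
  /-- The reversed rule `[ac][c̄b] ⟶ ab`. -/
  | interleave_symm (a b : Letter P) (c : P) (x y : Letter P) : pmul a.1 b.1 = none →
      pmul a.1 c = some x.1 → pmul (bar c) b.1 = some y.1 → thueSystem P [x, y] [a, b]

/-- The universal group `U(P) = Γ* / S(P)`. -/
abbrev UniversalGroup (P : Type*) [Pregroup P] : Type _ :=
  SemiThue.QuotientMonoid (thueSystem P)

theorem bar_ne_eps {P : Type*} [Pregroup P] {a : P} (h : a ≠ eps) : bar a ≠ eps := by
  intro hb
  have h1 := pmul_bar a
  rw [hb, pmul_eps] at h1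
  exact h (Option.some.inj h1)

/-- `U(P)` is indeed a group. -/
theorem isUnit_universalGroup (P : Type*) [Pregroup P] (g : UniversalGroup P) : IsUnit g := by
  have letter : ∀ a b : Letter P, pmul a.1 b.1 = some eps →
      (PresentedMonoid.of _ a * PresentedMonoid.of _ b : UniversalGroup P) = 1 := by
    intro a b h
    exact (Con.eq _).2 (ConGen.Rel.of (FreeMonoid.of a * FreeMonoid.of b) 1
      (thueSystem.cancel a b h))
  induction g using PresentedMonoid.inductionOn with
  | _ w =>
    induction w using FreeMonoid.inductionOn' with
    | one => exact isUnit_one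
    | of_mul a w ih =>
      rw [map_mul]
      refine IsUnit.mul ?_ ih
      exact ⟨⟨_, _, letter a ⟨bar a.1, bar_ne_eps a.2⟩ (pmul_bar a.1),
        letter ⟨bar a.1, bar_ne_eps a.2⟩ a (bar_pmul a.1)⟩, rfl⟩

end Pregroup

/-! Split the rules into reductions (`Red`: replace ab by the word of [ab], empty if [ab] = ε) and
symmetric length-preserving moves (`Exch`: interleavings, and the swaps [ab] ↔ [ba] supplied by the
short critical pairs). Conjugacy in U(P) is generated by cyclic steps, so conjugate words are joined
by a zigzag of these moves, and it remains to flatten such a zigzag between irreducible words.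

Two local conditions suffice: two reductions of w are connected through words shorter than w
(`red_confluent`), and an exchange of w transports each reduction of w to a reduction of the new
word, the results again being connected below |w| (`exch_coherent`). Lowering the top length of a
zigzag step by step then leaves only exchanges. Axiom (P5) handles overlaps of an interleaving with
a reduction. The genuinely cyclic case is a word of length two, reducible as ab and as ba; there the
swaps are indispensable. Consequently irreducible and geodesic coincide. -/

namespace LengthRewriting

/-! ### Abstract rewriting: zigzags bounded by length -/

variable {α : Type*} (len : α → ℕ) (R E : α → α → Prop)

/-- One undirected step of `R` or a step of `E`. -/
def Link (c d : α) : Prop := R c d ∨ R d c ∨ E c d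

/-- Connectedness through elements of length less than `n`. -/
def ConnBelow (n : ℕ) : α → α → Prop :=
  Relation.ReflTransGen fun c d => Link R E c d ∧ len c < n ∧ len d < n

/-- No `R`-step starts at `c`. -/
def Irred (c : α) : Prop := ∀ d, ¬ R c d

variable {len R E}

theorem ConnBelow.mono {m n : ℕ} (h : m ≤ n) {c d : α} (hc : ConnBelow len R E m c d) :
    ConnBelow len R E n c d :=
  Relation.ReflTransGen.mono (fun _ _ hab => ⟨hab.1, hab.2.1.trans_le h, hab.2.2.trans_le h⟩) _ _ hc

theorem exists_connBelow {c d : α} (h : Relation.ReflTransGen (Link R E) c d) :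
    ∃ n, ConnBelow len R E n c d := by
  induction h with
  | refl => exact ⟨0, .refl⟩
  | @tail y z _ hyz ih =>
    obtain ⟨n, hn⟩ := ih
    exact ⟨max n (max (len y) (len z) + 1),
      (hn.mono (le_max_left _ _)).tail ⟨hyz, by omega, by omega⟩⟩

theorem ConnBelow.symm (hE : ∀ c d, E c d → E d c) {n : ℕ} {c d : α}
    (h : ConnBelow len R E n c d) : ConnBelow len R E n d c := by
  induction h with
  | refl => exact .refl
  | tail _ hyz ih =>
    refine .head ⟨?_, hyz.2.2, hyz.2.1⟩ ih
    rcases hyz.1 with h | h | h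
    exacts [.inr (.inl h), .inl h, .inr (.inr (hE _ _ h))]

theorem exists_irred (hR : ∀ c d, R c d → len d < len c) (c : α) :
    ∃ d, Relation.ReflTransGen R c d ∧ Irred R d := by
  induction h : len c using Nat.strong_induction_on generalizing c with
  | _ n ih =>
    by_cases hc : Irred R c
    · exact ⟨c, .refl, hc⟩
    · obtain ⟨d, hd⟩ : ∃ d, R c d := by simpa [Irred] using hc
      obtain ⟨e, he, hi⟩ := ih (len d) (h ▸ hR _ _ hd) d rfl
      exact ⟨e, .head hd he, hi⟩

section Confluence

variable (hR : ∀ c d, R c d → len d < len c) (hlen : ∀ c d, E c d → len d = len c)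
  (hE : ∀ c d, E c d → E d c)
  (confluent : ∀ w u v, R w u → R w v → ConnBelow len R E (len w) u v)
  (coherent : ∀ w v u, E w v → R w u → ∃ u', R v u' ∧ ConnBelow len R E (len w) u u')

-- Since `E` is symmetric, coherence carries a reduction back along the chain, step by step, to one
-- of `u`.
include hlen hE coherent in
theorem irred_of_reflTransGen {u z : α} (hu : Irred R u) (h : Relation.ReflTransGen E u z) :
    Irred R z ∧ len z = len u := by
  induction h with
  | refl => exact ⟨hu, rfl⟩
  | tail _ hyz ih =>
    refine ⟨fun d hd => ?_, (hlen _ _ hyz).trans ih.2⟩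
    obtain ⟨u', hu', -⟩ := coherent _ _ _ (hE _ _ hyz) hd
    exact ih.1 _ hu'

include hlen in
theorem connBelow_of_reflTransGen {n : ℕ} {u z : α} (hu : len u < n)
    (h : Relation.ReflTransGen E u z) : ConnBelow len R E n u z ∧ len z < n := by
  induction h with
  | refl => exact ⟨.refl, hu⟩
  | tail _ hyz ih =>
    have := hlen _ _ hyz
    exact ⟨ih.1.tail ⟨.inr (.inr hyz), ih.2, this ▸ ih.2⟩, this ▸ ih.2⟩

-- This is the invariant along a zigzag of lengths at most `n` that starts at an irreducible `u`.
-- Once the zigzag leaves the `E`-class of `u`, every point of length `n` has a reduct connected to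
-- `u` strictly below `n`, so an irreducible endpoint is never in the third case.
include hR hlen hE confluent coherent in
theorem connBelow_succ_cases {n : ℕ} {u z : α} (hu : Irred R u)
    (h : ConnBelow len R E (n + 1) u z) :
    Relation.ReflTransGen E u z ∨ (ConnBelow len R E n u z ∧ len z < n) ∨
      (len z = n ∧ ∃ z', R z z' ∧ ConnBelow len R E n u z') := by
  induction h with
  | refl => exact .inl .refl
  | @tail z z₁ _ hzz ih =>
    obtain ⟨hl, hz, hz₁⟩ := hzz
    rcases ih with h | ⟨h, hzn⟩ | ⟨hzn, z', hzz', h⟩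
    · obtain ⟨hirr, hzu⟩ := irred_of_reflTransGen hlen hE coherent hu h
      rcases hl with hl | hl | hl
      · exact absurd hl (hirr _)
      · have h1 := hR _ _ hl
        obtain ⟨h2, h3⟩ := connBelow_of_reflTransGen (R := R) (n := n) hlen (by omega) h
        rcases (Nat.lt_succ_iff.1 hz₁).lt_or_eq with h4 | h4
        · exact .inr (.inl ⟨h2.tail ⟨.inr (.inl hl), h3, h4⟩, h4⟩)
        · exact .inr (.inr ⟨h4, z, hl, h2⟩)
      · exact .inl (h.tail hl)
    · rcases (Nat.lt_succ_iff.1 hz₁).lt_or_eq with h4 | h4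
      · exact .inr (.inl ⟨h.tail ⟨hl, hzn, h4⟩, h4⟩)
      · rcases hl with hl | hl | hl
        · have := hR _ _ hl
          omega
        · exact .inr (.inr ⟨h4, z, hl, h⟩)
        · have := hlen _ _ hl
          omega
    · rcases hl with hl | hl | hl
      -- The recorded reduct and the next point form a peak at `z`; confluence bypasses it below
      -- `n`.
      · exact .inr (.inl ⟨h.trans (hzn ▸ confluent _ _ _ hzz' hl), hzn ▸ hR _ _ hl⟩)
      · have := hR _ _ hl
        omega
      · obtain ⟨u', h1, h2⟩ := coherent _ _ _ hl hzz'
        exact .inr (.inr ⟨(hlen _ _ hl).trans hzn, u', h1, h.trans (hzn ▸ h2)⟩)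

include hR hlen hE confluent coherent in
/-- If peaks can be resolved below their top, connected irreducible elements are joined by
length-preserving steps. -/
theorem reflTransGen_of_irred {u v : α} (hu : Irred R u) (hv : Irred R v)
    (h : Relation.ReflTransGen (Link R E) u v) : Relation.ReflTransGen E u v := by
  obtain ⟨n, hn⟩ := exists_connBelow (len := len) h
  clear h
  induction n with
  | zero =>
    rcases hn.cases_head with rfl | ⟨_, h, _⟩
    · exact .refl
    · exact absurd h.2.1 (Nat.not_lt_zero _)
  | succ n ih =>
    rcases connBelow_succ_cases hR hlen hE confluent coherent hu hn with h | h | ⟨-, z, h, -⟩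
    exacts [h, ih h.1, absurd h (hv _)]

end Confluence

end LengthRewriting

/-! ### Adjacent pairs in cyclic words -/

namespace Cycle

variable {α : Type*}

theorem coe_append_comm (p q : List α) : ((p ++ q : List α) : Cycle α) = (q ++ p : List α) :=
  Cycle.coe_eq_coe.2 List.isRotated_append

/-- The possible relative positions of two adjacent pairs in a cyclic word. -/
theorem coe_cons_cons_eq {a b a' b' : α} {q q' : List α}
    (h : ((a :: b :: q : List α) : Cycle α) = (a' :: b' :: q' : List α)) :
    (a' = a ∧ b' = b ∧ q' = q) ∨ (a' = b ∧ b' = a ∧ q = [] ∧ q' = []) ∨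
      (∃ t, a' = b ∧ q = b' :: t ∧ q' = t ++ [a]) ∨
      (∃ t, b' = a ∧ q = t ++ [a'] ∧ q' = b :: t) ∨
      ∃ s t, q = s ++ a' :: b' :: t ∧ q' = t ++ a :: b :: s := by
  obtain ⟨n, hn, h⟩ := List.isRotated_iff_mod.1 (Cycle.coe_eq_coe.1 h)
  rw [List.rotate_eq_drop_append_take hn] at h
  have hs := List.take_append_drop n (a :: b :: q)
  generalize List.take n (a :: b :: q) = l₁ at h hs
  generalize List.drop n (a :: b :: q) = l₂ at h hs
  -- The rotation cuts before the pair `ab`, between `a` and `b`, or after it.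
  rcases l₁ with _ | ⟨c, _ | ⟨d, s⟩⟩
  · simp_all
  · rcases q with _ | ⟨e, t⟩ <;> simp_all
  · rcases l₂ with _ | ⟨e, _ | ⟨f, t⟩⟩
    · simp_all
    · obtain ⟨rfl, rfl, rfl⟩ : e = a' ∧ c = b' ∧ d :: s = q' := by simpa using h
      obtain ⟨rfl, rfl, rfl⟩ : a = c ∧ b = d ∧ q = s ++ [e] := by simpa using hs.symm
      exact .inr (.inr (.inr (.inl ⟨s, rfl, rfl, rfl⟩)))
    · right; right; right; right
      refine ⟨s, t, ?_, ?_⟩ <;> simp_all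

end Cycle

/-! ### Conjugacy and cyclic rewriting -/

namespace SemiThue

variable {Γ : Type*} (S : SemiThue Γ)

theorem toQuotient_append (u v : List Γ) :
    S.toQuotient (u ++ v) = S.toQuotient u * S.toQuotient v :=
  map_mul (PresentedMonoid.mk _) (FreeMonoid.ofList u) (FreeMonoid.ofList v)

variable {S}

theorem toQuotient_eq_of_rule {l r : List Γ} (h : S l r) : S.toQuotient l = S.toQuotient r :=
  (Con.eq _).2 (ConGen.Rel.of (FreeMonoid.ofList l) (FreeMonoid.ofList r) h)

theorem toQuotient_eq_of_step {u v : List Γ} (h : S.Step u v) :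
    S.toQuotient u = S.toQuotient v := by
  obtain ⟨p, q, l, r, h, rfl, rfl⟩ := h
  simp only [toQuotient_append, toQuotient_eq_of_rule h]

/-- A rotation moves a suffix to the front, which is conjugation by that suffix. -/
theorem Conj.of_coe_eq (hS : ∀ g : S.QuotientMonoid, IsUnit g) {u v : List Γ}
    (h : (u : Cycle Γ) = v) : S.Conj u v := by
  obtain ⟨n, hn, rfl⟩ := List.isRotated_iff_mod.1 (Cycle.coe_eq_coe.1 h)
  rw [List.rotate_eq_drop_append_take hn]
  obtain ⟨x, hx⟩ := hS (S.toQuotient (u.drop n))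
  refine ⟨x, ?_⟩
  conv_lhs => rw [← List.take_append_drop n u]
  simp only [SemiconjBy, hx, toQuotient_append, mul_assoc]

theorem Conj.of_cStep (hS : ∀ g : S.QuotientMonoid, IsUnit g) {u v : List Γ}
    (h : S.CStep (u : Cycle Γ) v) : S.Conj u v := by
  obtain ⟨u', v', hu, hv, h⟩ := h
  have h1 : S.Conj u' v' := by
    unfold Conj
    rw [toQuotient_eq_of_step h]
  exact ((Conj.of_coe_eq hS hu.symm).trans h1).trans (Conj.of_coe_eq hS hv)

theorem Conj.of_cDagger (hS : ∀ g : S.QuotientMonoid, IsUnit g) {u v : List Γ}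
    (h : S.CDagger (u : Cycle Γ) v) : S.Conj u v := by
  have key : ∀ u v : List Γ, S.CriticalPair (u : Cycle Γ) v → S.Conj u v := by
    rintro u v ⟨w, -, h1, h2, -⟩
    induction w using Quotient.inductionOn' with
    | _ w => exact (Conj.of_cStep hS (u := w) h1).symm.trans (Conj.of_cStep hS (u := w) h2)
  rcases h with h | h | h
  exacts [.of_cStep hS h, key _ _ h, (key _ _ h).symm]

theorem Conj.of_reflTransGen (hS : ∀ g : S.QuotientMonoid, IsUnit g)
    {u v : List Γ} (h : Relation.ReflTransGen S.CDagger (u : Cycle Γ) v) : S.Conj u v := by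
  generalize hc : (v : Cycle Γ) = c at h
  induction h generalizing v with
  | refl => exact .of_coe_eq hS hc.symm
  | @tail y z _ hyz ih =>
    subst hc
    induction y using Quotient.inductionOn' with
    | _ y => exact (ih (v := y) rfl).trans (Conj.of_cDagger hS hyz)

theorem CStep.of_rule {l r : List Γ} (h : S l r) (q : List Γ) :
    S.CStep ((l ++ q : List Γ) : Cycle Γ) (r ++ q : List Γ) :=
  ⟨_, _, rfl, rfl, [], q, l, r, h, rfl, rfl⟩

theorem cStep_iff {c d : Cycle Γ} : S.CStep c d ↔ ∃ l r q : List Γ, S l r ∧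
    c = (l ++ q : List Γ) ∧ d = (r ++ q : List Γ) := by
  constructor
  · rintro ⟨_, _, rfl, rfl, p, q, l, r, h, rfl, rfl⟩
    refine ⟨l, r, q ++ p, h, ?_, ?_⟩
    · rw [List.append_assoc, Cycle.coe_append_comm, List.append_assoc]
    · rw [List.append_assoc, Cycle.coe_append_comm, List.append_assoc]
  · rintro ⟨l, r, q, h, rfl, rfl⟩
    exact .of_rule h q

/-- Equality in the quotient implies connectedness by cyclic steps, in any context. -/
theorem eqvGen_of_toQuotient_eq {u v : List Γ} (h : S.toQuotient u = S.toQuotient v)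
    (q : List Γ) :
    Relation.EqvGen S.CStep ((u ++ q : List Γ) : Cycle Γ) (v ++ q : List Γ) := by
  have key : ∀ u v : FreeMonoid Γ, ConGen.Rel (fun u v => S u.toList v.toList) u v →
      ∀ p q : List Γ, Relation.EqvGen S.CStep ((p ++ (u.toList ++ q) : List Γ) : Cycle Γ)
        (p ++ (v.toList ++ q) : List Γ) := by
    intro u v h
    induction h with
    | of u v h =>
      exact fun p q => .rel _ _ ⟨_, _, rfl, rfl, p, q, _, _, h, by simp, by simp⟩
    | refl u => exact fun p q => .refl _
    | symm _ ih => exact fun p q => .symm _ _ (ih p q)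
    | trans _ _ ih₁ ih₂ => exact fun p q => .trans _ _ _ (ih₁ p q) (ih₂ p q)
    | @mul w x y z _ _ ih₁ ih₂ =>
      intro p q
      have h1 := ih₁ p (y.toList ++ q)
      have h2 := ih₂ (p ++ x.toList) q
      simp only [List.append_assoc] at h2
      simpa using h1.trans _ _ _ h2
  exact key _ _ ((Con.eq _).1 h) [] q

/-- With words s, t for x and x⁻¹, the chain is u, tsu, its rotation sut, vst, its rotation stv, and
v. -/
theorem Conj.eqvGen {u v : List Γ} (h : S.Conj u v) :
    Relation.EqvGen S.CStep (u : Cycle Γ) v := by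
  obtain ⟨x, hx⟩ := h
  obtain ⟨s, hs⟩ : ∃ s : List Γ, S.toQuotient s = x := by
    obtain ⟨s, hs⟩ := PresentedMonoid.surjective_mk (x : S.QuotientMonoid)
    exact ⟨s.toList, hs⟩
  obtain ⟨t, ht⟩ : ∃ t : List Γ, S.toQuotient t = (x⁻¹ : (S.QuotientMonoid)ˣ) := by
    obtain ⟨s, hs⟩ := PresentedMonoid.surjective_mk
      ((x⁻¹ : (S.QuotientMonoid)ˣ) : S.QuotientMonoid)
    exact ⟨s.toList, hs⟩
  have h1 : S.toQuotient [] = 1 := map_one (PresentedMonoid.mk _)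
  have e1 : S.toQuotient u = S.toQuotient (t ++ (s ++ u)) := by
    simp [toQuotient_append, hs, ht]
  have e2 : S.toQuotient (s ++ u) = S.toQuotient (v ++ s) := by
    simpa [toQuotient_append, hs] using hx.eq
  have e3 : S.toQuotient (s ++ t) = S.toQuotient [] := by
    simp [toQuotient_append, hs, ht, h1]
  have a1 := eqvGen_of_toQuotient_eq e1 []
  have a2 := eqvGen_of_toQuotient_eq e2 t
  have a3 := eqvGen_of_toQuotient_eq e3 v
  simp only [List.append_nil, List.nil_append] at a1 a3
  rw [Cycle.coe_append_comm t] at a1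
  rw [List.append_assoc v, Cycle.coe_append_comm v] at a2
  exact (a1.trans _ _ _ a2).trans _ _ _ a3

end SemiThue

/-! ### Pregroup arithmetic of interleavings -/

namespace Pregroup

variable {P : Type*} [Pregroup P]

theorem pmul_bar_right {a b x : P} (h : pmul a b = some x) : pmul x (bar b) = some a := by
  rw [pmul_assoc a b (bar b) x eps h (pmul_bar b), pmul_eps]

theorem pmul_bar_left {a b x : P} (h : pmul a b = some x) : pmul (bar a) x = some b := by
  rw [← pmul_assoc (bar a) a b eps x (bar_pmul a) h, eps_pmul]

theorem eq_bar_of_pmul_eq_eps {a b : P} (h : pmul a b = some eps) : b = bar a := by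
  have := pmul_bar_left h
  rw [pmul_eps] at this
  exact (Option.some.inj this).symm

theorem ne_eps_of_pmul_eq_none {a b : P} (h : pmul a b = none) : a ≠ eps ∧ b ≠ eps := by
  constructor
  · rintro rfl
    simp [eps_pmul] at h
  · rintro rfl
    simp [pmul_eps] at h

theorem bar_pmul_bar_eq_none {a b : P} (h : pmul a b = none) :
    pmul (bar b) (bar a) = none := by
  by_contra hne
  obtain ⟨x, hx⟩ := Option.ne_none_iff_exists'.1 hne
  have := bar_of_pmul _ _ _ hx
  simp [bar_bar, h] at this

theorem interleave_pmul {a b c x y : P} (hac : pmul a c = some x)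
    (hcb : pmul (bar c) b = some y) : pmul x y = pmul a b :=
  (pmul_assoc x (bar c) b a y (pmul_bar_right hac) hcb).symm

/-- Apply (P5) to x, c̄, b, d: the product (xc̄)b = ab is undefined, so (c̄b)d must be defined. -/
theorem interleave_right {a b c d x y e : P} (hab : pmul a b = none) (hac : pmul a c = some x)
    (hcb : pmul (bar c) b = some y) (hbd : pmul b d = some e) : ∃ f, pmul y d = some f := by
  have := pmul_or x (bar c) b d a y e (pmul_bar_right hac) hcb hbd
  rw [hab] at this
  exact Option.isSome_iff_exists.1 (this.resolve_left (by simp))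

/-- Apply (P5) to d, a, c, y: here (ac)y = xy = ab is undefined. -/
theorem interleave_left {a b c d x y e : P} (hab : pmul a b = none) (hac : pmul a c = some x)
    (hcb : pmul (bar c) b = some y) (hda : pmul d a = some e) : ∃ f, pmul e c = some f := by
  have hcy : pmul c y = some b := by simpa [bar_bar] using pmul_bar_left hcb
  have := pmul_or d a c y e x b hda hac hcy
  rw [interleave_pmul hac hcb, hab] at this
  exact Option.isSome_iff_exists.1 (this.resolve_right (by simp))

/-- From bs̄ = z̄, `interleave_right` makes (c̄b)s̄ = c̄z̄ defined; now invert. -/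
theorem interleave_dom {a b c z x y s : P} (hab : pmul a b = none) (hac : pmul a c = some x)
    (hcb : pmul (bar c) b = some y) (hzb : pmul z b = some s) : ∃ f, pmul z c = some f := by
  have hs : pmul b (bar s) = some (bar z) := by
    simpa [bar_bar] using pmul_bar_left (bar_of_pmul _ _ _ hzb)
  obtain ⟨f, hf⟩ := interleave_right hab hac hcb hs
  rw [pmul_assoc _ _ _ _ _ hcb hs] at hf
  exact ⟨bar f, by simpa [bar_bar] using bar_of_pmul _ _ _ hf⟩

/-- If `ba = e` is defined and `ab` is not, then interleaving `ab` by `c` conjugates `e` by `c`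
inside the pregroup. -/
theorem interleave_cyclic {a b c x y e : P} (hab : pmul a b = none) (hac : pmul a c = some x)
    (hcb : pmul (bar c) b = some y) (hba : pmul b a = some e) :
    ∃ f g, pmul y x = some f ∧ pmul c g = some e ∧ pmul g c = some f := by
  have h1 : pmul (bar e) b = some (bar a) := by
    simpa [bar_bar] using bar_of_pmul _ _ _ (pmul_bar_left hba)
  obtain ⟨k, hk⟩ := interleave_dom hab hac hcb h1
  have hg : pmul (bar c) e = some (bar k) := by simpa [bar_bar] using bar_of_pmul _ _ _ hk
  have hya : pmul y a = some (bar k) := by rw [pmul_assoc _ _ _ _ _ hcb hba, hg]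
  have hbc : pmul (bar b) c = some (bar y) := by simpa [bar_bar] using bar_of_pmul _ _ _ hcb
  -- The inverse pair b̄, ā is interleaved by the same c, and (ya)ā = y is defined, so (ya)c is
  -- defined; here ya = c̄e is the witness g.
  obtain ⟨f, hf⟩ := interleave_dom (bar_pmul_bar_eq_none hab) hbc (bar_of_pmul _ _ _ hac)
    (pmul_bar_right hya)
  refine ⟨f, bar k, ?_, ?_, hf⟩
  · rw [← pmul_assoc _ _ _ _ _ hya hac, hf]
  · simpa [bar_bar] using pmul_bar_left hg

/-! ### Reductions, interleavings and swaps of cyclic words -/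

open Classical in
/-- The word of length at most one that represents an element of the pregroup. -/
noncomputable def word (p : P) : List (Letter P) := if h : p = eps then [] else [⟨p, h⟩]

theorem word_eps : word (eps : P) = [] := by simp [word]

theorem word_of_ne {p : P} (h : p ≠ eps) : word p = [⟨p, h⟩] := by simp [word, h]

theorem word_letter (a : Letter P) : word a.1 = [a] := word_of_ne a.2

theorem length_word_le (p : P) : (word p).length ≤ 1 := by
  unfold word
  split <;> simp

/-- Length-reducing cyclic steps. -/
def Red (c d : Cycle (Letter P)) : Prop :=
  ∃ (a b : Letter P) (x : P) (q : List (Letter P)), pmul a.1 b.1 = some x ∧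
    c = (a :: b :: q : List (Letter P)) ∧ d = (word x ++ q : List (Letter P))

/-- Cyclic interleaving steps. -/
def Interleave (c d : Cycle (Letter P)) : Prop :=
  ∃ (a b : Letter P) (z : P) (x y : Letter P) (q : List (Letter P)), pmul a.1 b.1 = none ∧
    pmul a.1 z = some x.1 ∧ pmul (bar z) b.1 = some y.1 ∧
    c = (a :: b :: q : List (Letter P)) ∧ d = (x :: y :: q : List (Letter P))

/-- The exchange of `[ab]` and `[ba]`. -/
def Swap (c d : Cycle (Letter P)) : Prop :=
  ∃ a b x y : Letter P, pmul a.1 b.1 = some x.1 ∧ pmul b.1 a.1 = some y.1 ∧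
    c = ([x] : List (Letter P)) ∧ d = ([y] : List (Letter P))

/-- Length-preserving cyclic steps. -/
def Exch (c d : Cycle (Letter P)) : Prop := Interleave c d ∨ Swap c d

theorem Red.length_lt {c d : Cycle (Letter P)} (h : Red c d) : d.length < c.length := by
  obtain ⟨a, b, x, q, -, rfl, rfl⟩ := h
  have := length_word_le x
  simp only [Cycle.length_coe, List.length_append, List.length_cons]
  omega

theorem Exch.length_eq {c d : Cycle (Letter P)} (h : Exch c d) : d.length = c.length := by
  rcases h with ⟨a, b, z, x, y, q, -, -, -, rfl, rfl⟩ | ⟨a, b, x, y, -, -, rfl, rfl⟩ <;> rfl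

theorem Interleave.symm {c d : Cycle (Letter P)} (h : Interleave c d) : Interleave d c := by
  obtain ⟨a, b, z, x, y, q, h1, h2, h3, rfl, rfl⟩ := h
  refine ⟨x, y, bar z, a, b, q, (interleave_pmul h2 h3).trans h1, pmul_bar_right h2,
    pmul_bar_left h3, rfl, rfl⟩

theorem Exch.symm {c d : Cycle (Letter P)} (h : Exch c d) : Exch d c := by
  rcases h with h | ⟨a, b, x, y, h1, h2, rfl, rfl⟩
  · exact .inl h.symm
  · exact .inr ⟨b, a, y, x, h2, h1, rfl, rfl⟩

theorem cStep_cases {c d : Cycle (Letter P)} (h : SemiThue.CStep (thueSystem P) c d) :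
    Red c d ∨ Interleave c d := by
  obtain ⟨l, r, q, hr, rfl, rfl⟩ := SemiThue.cStep_iff.1 h
  cases hr with
  | cancel a b hr => exact .inl ⟨a, b, eps, q, hr, rfl, by simp [word_eps]⟩
  | mul a b x hr => exact .inl ⟨a, b, x.1, q, hr, rfl, by simp [word_letter]⟩
  | interleave a b z x y h1 h2 h3 => exact .inr ⟨a, b, z, x, y, q, h1, h2, h3, rfl, rfl⟩
  | interleave_symm a b z x y h1 h2 h3 =>
    exact .inr (Interleave.symm ⟨a, b, z, x, y, q, h1, h2, h3, rfl, rfl⟩)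

theorem Red.cStep {c d : Cycle (Letter P)} (h : Red c d) : SemiThue.CStep (thueSystem P) c d := by
  obtain ⟨a, b, x, q, h, rfl, rfl⟩ := h
  by_cases hx : x = eps
  · subst hx
    rw [word_eps]
    exact SemiThue.CStep.of_rule (thueSystem.cancel a b h) q
  · rw [word_of_ne hx]
    exact SemiThue.CStep.of_rule (thueSystem.mul a b ⟨x, hx⟩ h) q

theorem Interleave.cStep {c d : Cycle (Letter P)} (h : Interleave c d) :
    SemiThue.CStep (thueSystem P) c d := by
  obtain ⟨a, b, z, x, y, q, h1, h2, h3, rfl, rfl⟩ := h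
  exact SemiThue.CStep.of_rule (thueSystem.interleave a b z x y h1 h2 h3) q

theorem leftBound_le : SemiThue.leftBound (thueSystem P) ≤ 2 :=
  iSup_le fun l => iSup_le fun r => iSup_le fun h => by cases h <;> exact le_rfl

theorem Swap.criticalPair {c d : Cycle (Letter P)} (h : Swap c d) :
    SemiThue.CriticalPair (thueSystem P) c d := by
  obtain ⟨a, b, x, y, h1, h2, rfl, rfl⟩ := h
  have r1 : thueSystem P [a, b] [x] := .mul a b x h1
  have r2 : thueSystem P [b, a] [y] := .mul b a y h2
  refine ⟨([a, b] : List (Letter P)), ?_, .of_rule r1 [], ?_, ?_⟩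
  -- The rule ab → [ab] itself witnesses m(S) ≥ 2, so a word of length two is short.
  · have : (2 : ℕ∞) ≤ SemiThue.leftBound (thueSystem P) :=
      le_iSup_of_le [a, b] (le_iSup_of_le [x] (le_iSup_of_le r1 le_rfl))
    calc (2 : ℕ∞) + 2 = 2 * 2 := by norm_num
      _ ≤ 2 * SemiThue.leftBound (thueSystem P) := by gcongr
  · exact (Cycle.coe_append_comm [a] [b]) ▸ SemiThue.CStep.of_rule r2 []
  · simp

theorem Exch.cDagger {c d : Cycle (Letter P)} (h : Exch c d) :
    SemiThue.CDagger (thueSystem P) c d :=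
  h.elim (fun h => .inl h.cStep) fun h => .inr (.inl h.criticalPair)

/-! ### Resolving peaks below their top -/

open LengthRewriting

/-- Connectedness of cyclic words through cyclic words of length less than `n`. -/
abbrev CConn (n : ℕ) : Cycle (Letter P) → Cycle (Letter P) → Prop :=
  ConnBelow Cycle.length Red Exch n

theorem CConn.of_red {n : ℕ} {c d : Cycle (Letter P)} (h : Red c d) (hc : c.length < n) :
    CConn n c d :=
  .single ⟨.inl h, hc, h.length_lt.trans hc⟩

theorem CConn.of_exch {n : ℕ} {c d : Cycle (Letter P)} (h : Exch c d) (hc : c.length < n) :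
    CConn n c d :=
  .single ⟨.inr (.inr h), hc, h.length_eq ▸ hc⟩

theorem CConn.symm {n : ℕ} {c d : Cycle (Letter P)} (h : CConn n c d) : CConn n d c :=
  ConnBelow.symm (fun _ _ => Exch.symm) h

theorem cConn_pmul {p q r : P} (h : pmul p q = some r) (t : List (Letter P)) {n : ℕ}
    (hn : t.length + 2 < n) :
    CConn n ((word p ++ word q ++ t : List (Letter P)) : Cycle (Letter P))
      ((word r ++ t : List (Letter P)) : Cycle (Letter P)) := by
  by_cases hp : p = eps
  · subst hp
    rw [eps_pmul] at h
    obtain rfl := Option.some.inj h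
    rw [word_eps]
    exact .refl
  by_cases hq : q = eps
  · subst hq
    rw [pmul_eps] at h
    obtain rfl := Option.some.inj h
    rw [word_eps, List.append_nil]
    exact .refl
  rw [word_of_ne hp, word_of_ne hq]
  exact .of_red ⟨⟨p, hp⟩, ⟨q, hq⟩, r, t, h, rfl, rfl⟩ (by simpa using hn)

/-- If pq is defined there is no interleaving rule, but pq = xy and both sides reduce to it;
otherwise no factor is ε and the rule applies. -/
theorem cConn_interleave {p q c x y : P} (hx : pmul p c = some x) (hy : pmul (bar c) q = some y)
    (t : List (Letter P)) {n : ℕ} (hn : t.length + 2 < n) :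
    CConn n ((word p ++ word q ++ t : List (Letter P)) : Cycle (Letter P))
      ((word x ++ word y ++ t : List (Letter P)) : Cycle (Letter P)) := by
  have hxy := interleave_pmul hx hy
  cases h : pmul p q with
  | some r => exact (cConn_pmul h t hn).trans (cConn_pmul (hxy.trans h) t hn).symm
  | none =>
    obtain ⟨hp, hq⟩ := ne_eps_of_pmul_eq_none h
    obtain ⟨hx', hy'⟩ := ne_eps_of_pmul_eq_none (hxy.trans h)
    rw [word_of_ne hp, word_of_ne hq, word_of_ne hx', word_of_ne hy']
    exact .of_exch (.inl ⟨⟨p, hp⟩, ⟨q, hq⟩, c, ⟨x, hx'⟩, ⟨y, hy'⟩, t, h, hx, hy, rfl, rfl⟩)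
      (by simpa using hn)

/-- The bound 2 excludes the peak ab itself, so a swap is needed; when a factor or a product is ε,
both products agree. -/
theorem cConn_swap {a b x y : P} (hx : pmul a b = some x) (hy : pmul b a = some y) :
    CConn 2 (word x : Cycle (Letter P)) ((word y : List (Letter P)) : Cycle (Letter P)) := by
  by_cases ha : a = eps
  · subst ha
    rw [eps_pmul] at hx
    rw [pmul_eps] at hy
    obtain rfl := Option.some.inj (hx.symm.trans hy)
    exact .refl
  by_cases hb : b = eps
  · subst hb
    rw [pmul_eps] at hx
    rw [eps_pmul] at hy
    obtain rfl := Option.some.inj (hx.symm.trans hy)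
    exact .refl
  by_cases hxe : x = eps
  · subst hxe
    rw [eq_bar_of_pmul_eq_eps hx, bar_pmul] at hy
    obtain rfl := Option.some.inj hy
    exact .refl
  by_cases hye : y = eps
  · subst hye
    rw [eq_bar_of_pmul_eq_eps hy, bar_pmul] at hx
    exact absurd (Option.some.inj hx).symm hxe
  rw [word_of_ne hxe, word_of_ne hye]
  exact .of_exch (.inr ⟨⟨a, ha⟩, ⟨b, hb⟩, ⟨x, hxe⟩, ⟨y, hye⟩, hx, hy, rfl, rfl⟩) (by simp)

/-- Interleaving [ab], d by b̄ gives a, [bd]. -/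
theorem cConn_overlap {a b d : Letter P} {x y : P} (hx : pmul a.1 b.1 = some x)
    (hy : pmul b.1 d.1 = some y) (t : List (Letter P)) :
    CConn (t.length + 3) ((word x ++ d :: t : List (Letter P)) : Cycle (Letter P))
      ((word y ++ (t ++ [a]) : List (Letter P)) : Cycle (Letter P)) := by
  have := cConn_interleave (pmul_bar_right hx) (by rwa [bar_bar] : pmul (bar (bar b.1)) d.1 = _)
    t (Nat.lt_succ_self _)
  rw [word_letter, word_letter] at this
  rw [← List.append_assoc, Cycle.coe_append_comm (word y ++ t)]
  simpa using this

/-- Peaks of length-reducing steps resolve below the top. -/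
theorem red_confluent (w u v : Cycle (Letter P)) (hu : Red w u) (hv : Red w v) :
    CConn w.length u v := by
  obtain ⟨a, b, x, q, hx, rfl, rfl⟩ := hu
  obtain ⟨a', b', x', q', hx', hw, rfl⟩ := hv
  rcases Cycle.coe_cons_cons_eq hw with ⟨rfl, rfl, rfl⟩ | ⟨rfl, rfl, rfl, rfl⟩ |
    ⟨t, rfl, rfl, rfl⟩ | ⟨t, rfl, rfl, rfl⟩ | ⟨s, t, rfl, rfl⟩
  · obtain rfl := Option.some.inj (hx.symm.trans hx')
    exact .refl
  · simpa using cConn_swap hx hx'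
  · exact cConn_overlap hx hx' t
  · rw [hw]
    exact (cConn_overlap hx' hx t).symm
  -- Disjoint pairs: the reductions commute, and the common reduct is reached from both sides.
  · have h1 := length_word_le x
    have h2 := length_word_le x'
    have r1 : Red ((word x ++ (s ++ a' :: b' :: t) : List (Letter P)) : Cycle (Letter P))
        (word x' ++ (t ++ (word x ++ s)) : List (Letter P)) := by
      refine ⟨a', b', x', t ++ (word x ++ s), hx', ?_, rfl⟩
      rw [← List.append_assoc, Cycle.coe_append_comm]
      rfl
    have r2 : Red ((word x' ++ (t ++ a :: b :: s) : List (Letter P)) : Cycle (Letter P))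
        (word x' ++ (t ++ (word x ++ s)) : List (Letter P)) := by
      refine ⟨a, b, x, s ++ (word x' ++ t), hx, ?_, ?_⟩
      · rw [← List.append_assoc, Cycle.coe_append_comm]
        rfl
      · rw [← List.append_assoc, Cycle.coe_append_comm, List.append_assoc]
    refine (CConn.of_red r1 ?_).trans (CConn.of_red r2 ?_).symm
    · simp; omega
    · simp; omega

/-- Length-preserving steps are coherent with length-reducing ones. -/
theorem exch_coherent (w v u : Cycle (Letter P)) (hv : Exch w v) (hu : Red w u) :
    ∃ u', Red v u' ∧ CConn w.length u u' := by
  obtain ⟨a', b', e, q', he, rfl, rfl⟩ := hu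
  rcases hv with ⟨a, b, c, x, y, q, hab, hx, hy, hw, rfl⟩ | ⟨_, _, _, _, -, -, hw, -⟩
  swap
  -- A swap acts on a single letter, which admits no reduction.
  · have := congrArg Cycle.length hw
    simp at this
  rcases Cycle.coe_cons_cons_eq hw.symm with ⟨rfl, rfl, rfl⟩ | ⟨rfl, rfl, rfl, rfl⟩ |
    ⟨t, rfl, rfl, rfl⟩ | ⟨t, rfl, rfl, rfl⟩ | ⟨s, t, rfl, rfl⟩
  · simp [hab] at he
  -- The whole word is ab, with ba = e defined. After interleaving, yx = f is defined, and e = cg, f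
  -- = gc differ by a swap.
  · obtain ⟨f, g, hf, hcg, hgc⟩ := interleave_cyclic hab hx hy he
    refine ⟨_, ⟨y, x, f, [], hf, Cycle.coe_append_comm [x] [y], rfl⟩, ?_⟩
    simpa using cConn_swap hcg hgc
  · obtain ⟨f, hf⟩ := interleave_right hab hx hy he
    refine ⟨_, ⟨y, b', f, t ++ [x], hf, Cycle.coe_append_comm [x] (y :: b' :: t), rfl⟩, ?_⟩
    have hcf : pmul (bar c) e = some f := by rw [← pmul_assoc _ _ _ _ _ hy he, hf]
    have := cConn_interleave hx hcf t (Nat.lt_succ_self _)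
    rw [word_letter, word_letter] at this
    rw [← List.append_assoc, ← List.append_assoc, Cycle.coe_append_comm (word e ++ t),
      Cycle.coe_append_comm (word f ++ t)]
    simpa using this
  · obtain ⟨f, hf⟩ := interleave_left hab hx hy he
    have hf' : pmul a'.1 x.1 = some f := by rw [← pmul_assoc _ _ _ _ _ he hx, hf]
    refine ⟨_, ⟨a', x, f, y :: t, hf', Cycle.coe_append_comm (x :: y :: t) [a'], rfl⟩, ?_⟩
    have := cConn_interleave hf hy t (Nat.lt_succ_self _)
    rw [word_letter, word_letter] at this
    simpa using this
  · refine ⟨(word e ++ (t ++ x :: y :: s) : List (Letter P)),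
      ⟨a', b', e, t ++ x :: y :: s, he,
        Cycle.coe_append_comm (x :: y :: s) (a' :: b' :: t), rfl⟩, ?_⟩
    have := length_word_le e
    refine CConn.of_exch (.inl ⟨a, b, c, x, y, s ++ (word e ++ t), hab, hx, hy, ?_, ?_⟩) ?_
    · rw [← List.append_assoc, Cycle.coe_append_comm]
      rfl
    · rw [← List.append_assoc, Cycle.coe_append_comm]
      rfl
    · simp; omega

/-! ### Irreducible words are the geodesic ones -/

theorem reflTransGen_link_of_eqvGen {c d : Cycle (Letter P)}
    (h : Relation.EqvGen (SemiThue.CStep (thueSystem P)) c d) :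
    Relation.ReflTransGen (Link Red Exch) c d ∧ Relation.ReflTransGen (Link Red Exch) d c := by
  induction h with
  | rel x y h =>
    rcases cStep_cases h with h | h
    · exact ⟨.single (.inl h), .single (.inr (.inl h))⟩
    · exact ⟨.single (.inr (.inr (.inl h))), .single (.inr (.inr (.inl h.symm)))⟩
  | refl x => exact ⟨.refl, .refl⟩
  | symm _ _ _ ih => exact ih.symm
  | trans _ _ _ _ _ ih₁ ih₂ => exact ⟨ih₁.1.trans ih₂.1, ih₂.2.trans ih₁.2⟩

/-- Conjugate irreducible cyclic words are connected by length-preserving steps. -/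
theorem exch_of_conj {u v : List (Letter P)} (hu : Irred Red (u : Cycle (Letter P)))
    (hv : Irred Red (v : Cycle (Letter P))) (h : SemiThue.Conj (thueSystem P) u v) :
    Relation.ReflTransGen Exch (u : Cycle (Letter P)) v :=
  reflTransGen_of_irred (R := Red) (E := Exch) (fun _ _ => Red.length_lt)
    (fun _ _ => Exch.length_eq)
    (fun _ _ => Exch.symm) red_confluent exch_coherent hu hv
    (reflTransGen_link_of_eqvGen h.eqvGen).1

theorem Red.conj {u v : List (Letter P)}
    (h : Relation.ReflTransGen Red (u : Cycle (Letter P)) v) : SemiThue.Conj (thueSystem P) u v :=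
  .of_reflTransGen (isUnit_universalGroup P)
    (Relation.ReflTransGen.mono (fun _ _ h => .inl h.cStep) _ _ h)

theorem length_le_of_reflTransGen {c d : Cycle (Letter P)} (h : Relation.ReflTransGen Red c d) :
    d.length ≤ c.length := by
  induction h with
  | refl => exact le_rfl
  | tail _ h ih => exact h.length_lt.le.trans ih

theorem irred_of_isGeodesic {c : Cycle (Letter P)} (h : SemiThue.IsGeodesic (thueSystem P) c) :
    Irred Red c := by
  intro d hd
  induction c using Quotient.inductionOn' with | _ u => ?_
  induction d using Quotient.inductionOn' with | _ v => ?_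
  exact (h u v rfl (Red.conj (.single hd))).not_gt hd.length_lt

/-- Any conjugate word reduces to an irreducible one, which exchanges connect to `c`; so it has the
length of `c`. -/
theorem isGeodesic_of_irred {c : Cycle (Letter P)} (h : Irred Red c) :
    SemiThue.IsGeodesic (thueSystem P) c := by
  rintro u v rfl huv
  obtain ⟨d, hd, hirr⟩ := exists_irred (len := Cycle.length) (fun _ _ => Red.length_lt)
    (v : Cycle (Letter P))
  induction d using Quotient.inductionOn' with | _ d => ?_
  have h1 := exch_of_conj h hirr (huv.trans (Red.conj hd))
  have h2 : Cycle.length (d : Cycle (Letter P)) = Cycle.length (u : Cycle (Letter P)) :=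
    (irred_of_reflTransGen (len := Cycle.length) (fun _ _ => Exch.length_eq) (fun _ _ => Exch.symm)
      exch_coherent h h1).2
  rw [← h2]
  exact length_le_of_reflTransGen hd

theorem lengthPreserving_of_conj {u v : List (Letter P)}
    (hu : SemiThue.IsGeodesic (thueSystem P) (u : Cycle (Letter P)))
    (hv : SemiThue.IsGeodesic (thueSystem P) (v : Cycle (Letter P)))
    (h : SemiThue.Conj (thueSystem P) u v) :
    Relation.ReflTransGen (LengthPreserving (SemiThue.CDagger (thueSystem P)))
      (u : Cycle (Letter P)) (v : Cycle (Letter P)) :=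
  Relation.ReflTransGen.mono (fun _ _ h => ⟨h.cDagger, h.length_eq⟩) _ _
    (exch_of_conj (irred_of_isGeodesic hu) (irred_of_isGeodesic hv) h)

/-- A short word has length at most 2, so both sides of a critical pair have length exactly 1. -/
theorem criticalPair_length_eq {c d : Cycle (Letter P)}
    (h : SemiThue.CriticalPair (thueSystem P) c d) : d.length = c.length := by
  obtain ⟨w, hw, -, -, h1, h2, h3⟩ := h
  have : (w.length : ℕ∞) + 2 ≤ 2 * 2 := hw.trans (by gcongr; exact leftBound_le)
  have : w.length + 2 ≤ 2 * 2 := by exact_mod_cast this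
  omega

theorem isCyclicThue_cDagger : IsCyclicThue (SemiThue.CDagger (thueSystem P)) := by
  rintro c d (h | h | h)
  · rcases cStep_cases h with h | h
    · exact .inl h.length_lt
    · exact .inr ⟨Exch.length_eq (.inl h), .inl h.symm.cStep⟩
  · exact .inr ⟨criticalPair_length_eq h, .inr (.inr h)⟩
  · exact .inr ⟨(criticalPair_length_eq h).symm, .inr (.inl h)⟩

end Pregroup

theorem mainTheorem1 (P : Type*) [Pregroup P] :
    GeodesicallyPerfect (Pregroup.thueSystem P) (SemiThue.CDagger (Pregroup.thueSystem P)) ∧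
    ∀ u v : List (Pregroup.Letter P),
      SemiThue.IsGeodesic (Pregroup.thueSystem P) (u : Cycle (Pregroup.Letter P)) →
      SemiThue.IsGeodesic (Pregroup.thueSystem P) (v : Cycle (Pregroup.Letter P)) →
      SemiThue.Conj (Pregroup.thueSystem P) u v →
      Relation.ReflTransGen (LengthPreserving (SemiThue.CDagger (Pregroup.thueSystem P)))
        (u : Cycle (Pregroup.Letter P)) (v : Cycle (Pregroup.Letter P)) := by
  have hS := Pregroup.isUnit_universalGroup P
  refine ⟨⟨Pregroup.isCyclicThue_cDagger, fun _ _ => .inl,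
    fun _ _ => SemiThue.Conj.of_cDagger hS, ?_, ?_⟩,
    fun _ _ => Pregroup.lengthPreserving_of_conj⟩
  · intro w
    obtain ⟨u, hu, hirr⟩ := LengthRewriting.exists_irred (len := Cycle.length)
      (fun _ _ => Pregroup.Red.length_lt) w
    exact ⟨u, Relation.ReflTransGen.mono (fun _ _ h => ⟨.inl h.cStep, h.length_lt⟩) _ _ hu,
      Pregroup.isGeodesic_of_irred hirr⟩
  · intro w u v hu hv gu gv
    induction w using Quotient.inductionOn' with | _ w => ?_
    induction u using Quotient.inductionOn' with | _ u => ?_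
    induction v using Quotient.inductionOn' with | _ v => ?_
    exact Pregroup.lengthPreserving_of_conj gu gv
      ((SemiThue.Conj.of_reflTransGen hS (u := w) hu).symm.trans
        (SemiThue.Conj.of_reflTransGen hS (u := w) hv))
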